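/- Let $M$ be a closed (compact, connected, without boundary) smooth surface equipped with a hyperbolic metric $\sigma$, i.e. a smooth Riemannian metric of constant Gaussian curvature $-1$, of total area $A$. Then, for every $D>0$, there exists a smooth Riemannian metric $g$ on $M$ that is conformally equivalent to $\sigma$ (i.e. $g=e^{2u}\sigma$ for some smooth function $u\colon M\to\mathbb{R}$), has total area $A$, and satisfies $\operatorname{diam}(M,g)>D$. -/

import Mathlib

open Set MeasureTheory Manifold Bundle
open scoped ContDiff ENNReal

noncomputable section

namespace Surface

/-- The Euclidean plane, the model space of a surface. -/
abbrev Plane : Type := EuclideanSpace ℝ (Fin 2)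

/-- The standard basis vectors of the plane. -/
def stdVec (i : Fin 2) : Plane := EuclideanSpace.single i 1

/-- Smooth Riemannian metrics on a smooth surface `M`. -/
abbrev Metric (M : Type*) [TopologicalSpace M] [ChartedSpace Plane M] [IsManifold (𝓡 2) ∞ M] :
    Type _ :=
  ContMDiffRiemannianMetric (𝓡 2) ∞ Plane (fun x : M ↦ TangentSpace (𝓡 2) x)

/-! ### Curvature of a metric on an open subset of the plane -/

/-- Partial derivative in the `i`-th coordinate direction. -/
def pderiv (i : Fin 2) (f : Plane → ℝ) (y : Plane) : ℝ := fderiv ℝ f y (stdVec i)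

/-- Christoffel symbols `Γ^k_{ij}` of the metric with coefficient matrix `G`:
`Γ^k_{ij} = ½ ∑ l, G^{kl} (∂_i G_{jl} + ∂_j G_{il} - ∂_l G_{ij})`. -/
def christoffel (G : Plane → Matrix (Fin 2) (Fin 2) ℝ) (k i j : Fin 2) (y : Plane) : ℝ :=
  (1 / 2) * ∑ l, (G y)⁻¹ k l *
    (pderiv i (fun z ↦ G z j l) y + pderiv j (fun z ↦ G z i l) y - pderiv l (fun z ↦ G z i j) y)

/-- Components of the curvature tensor, `R(∂_i, ∂_j) ∂_k = ∑ l, (riemannTensor G l i j k) ∂_l`,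
with `R(X, Y) Z = ∇_X ∇_Y Z - ∇_Y ∇_X Z - ∇_{[X, Y]} Z`. -/
def riemannTensor (G : Plane → Matrix (Fin 2) (Fin 2) ℝ) (l i j k : Fin 2) (y : Plane) : ℝ :=
  pderiv i (christoffel G l j k) y - pderiv j (christoffel G l i k) y
    + ∑ m, (christoffel G l i m y * christoffel G m j k y
      - christoffel G l j m y * christoffel G m i k y)

/-- Gaussian curvature `⟨R(∂_0, ∂_1) ∂_1, ∂_0⟩ / det G` of the metric with coefficients `G`. -/
def planeCurvature (G : Plane → Matrix (Fin 2) (Fin 2) ℝ) (y : Plane) : ℝ :=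
  (∑ l, G y 0 l * riemannTensor G l 0 1 1 y) / (G y).det

theorem measurableSet_chart {M : Type*} [TopologicalSpace M] [ChartedSpace Plane M]
    [MeasurableSpace M] [BorelSpace M] (c : M) {s : Set M}
    (hs : MeasurableSet s) :
    MeasurableSet ((extChartAt (𝓡 2) c).target ∩ (extChartAt (𝓡 2) c).symm ⁻¹' s) := by
  have hopen : IsOpen (extChartAt (𝓡 2) c).target := isOpen_extChartAt_target c
  have h := (continuousOn_iff_continuous_domRestrict.1
    (continuousOn_extChartAt_symm (I := 𝓡 2) c)).measurable hs
  have := (MeasurableEmbedding.subtype_coe hopen.measurableSet).measurableSet_image.2 h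
  convert this using 1
  ext y
  simp [and_comm]

section

variable {M : Type*} [TopologicalSpace M] [ChartedSpace Plane M] [IsManifold (𝓡 2) ∞ M]

/-- The coefficients `g(∂_i, ∂_j)` of a metric in the preferred chart around `c`, as functions on
the (open) target of that chart. -/
def coeff (g : Metric M) (c : M) (y : Plane) : Matrix (Fin 2) (Fin 2) ℝ :=
  Matrix.of fun i j ↦ g.inner ((extChartAt (𝓡 2) c).symm y)
    (mfderiv 𝓘(ℝ, Plane) (𝓡 2) (extChartAt (𝓡 2) c).symm y (stdVec i))
    (mfderiv 𝓘(ℝ, Plane) (𝓡 2) (extChartAt (𝓡 2) c).symm y (stdVec j))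

/-- The Gaussian curvature of `g` at `x`, computed in the preferred chart around `x`. -/
def gaussCurvature (g : Metric M) (x : M) : ℝ :=
  planeCurvature (coeff g x) (extChartAt (𝓡 2) x x)

/-- A hyperbolic metric: the Gaussian curvature is constant equal to `-1`. -/
def IsHyperbolic (g : Metric M) : Prop := ∀ x, gaussCurvature g x = -1

/-- `g` is conformally equivalent to `σ`: `g = e^{2u} σ` for some smooth function `u`. -/
def IsConformal (g σ : Metric M) : Prop :=
  ∃ u : M → ℝ, ContMDiff (𝓡 2) 𝓘(ℝ, ℝ) ∞ u ∧
    ∀ (x : M) (v w : TangentSpace (𝓡 2) x), g.inner x v w = Real.exp (2 * u x) * σ.inner x v w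

/-- The Riemannian distance of `g`: the infimum of the `g`-lengths of `C^1` paths from `x` to `y`. -/
def gdist (g : Metric M) (x y : M) : ℝ≥0∞ :=
  letI : RiemannianBundle (fun x : M ↦ TangentSpace (𝓡 2) x) := ⟨g.toRiemannianMetric⟩
  riemannianEDist (𝓡 2) x y

/-- The diameter of `(M, g)`. -/
def diam (g : Metric M) : ℝ≥0∞ := ⨆ (x : M) (y : M), gdist g x y

/-- The `g`-area of (the part of `s` in) the domain of the preferred chart around `c`: the integral
of `√(det G)` over the corresponding subset of the plane. -/
def areaInChart (g : Metric M) (c : M) (s : Set M) : ℝ≥0∞ :=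
  ∫⁻ y in (extChartAt (𝓡 2) c).target ∩ (extChartAt (𝓡 2) c).symm ⁻¹' s,
    ENNReal.ofReal (√(coeff g c y).det)

/-- Change of variables: the area does not depend on the chart. -/
theorem areaInChart_congr [MeasurableSpace M] [BorelSpace M] (g : Metric M) (a b : M)
    {s : Set M} (hs : MeasurableSet s) (ha : s ⊆ (chartAt Plane a).source)
    (hb : s ⊆ (chartAt Plane b).source) : areaInChart g a s = areaInChart g b s := by
  rw [← extChartAt_source (𝓡 2)] at ha hb
  set φ := extChartAt (𝓡 2) a with hφ
  set ψ := extChartAt (𝓡 2) b with hψ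
  set f : Plane → Plane := φ ∘ ψ.symm with hf
  have himg : φ.target ∩ φ.symm ⁻¹' s = f '' (ψ.target ∩ ψ.symm ⁻¹' s) := by
    ext y
    constructor
    · rintro ⟨hy, hys⟩
      refine ⟨ψ (φ.symm y), ⟨ψ.map_source (hb hys), ?_⟩, ?_⟩
      · simpa [ψ.left_inv (hb hys)] using hys
      · simp [hf, ψ.left_inv (hb hys), φ.right_inv hy]
    · rintro ⟨z, ⟨hz, hzs⟩, rfl⟩
      refine ⟨φ.map_source (ha hzs), ?_⟩
      simpa [hf, φ.left_inv (ha hzs)] using hzs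
  have hinj : InjOn f (ψ.target ∩ ψ.symm ⁻¹' s) := by
    rintro y ⟨hy, hys⟩ z ⟨hz, hzs⟩ h
    exact ψ.symm.injOn hy hz (φ.injOn (ha hys) (ha hzs) h)
  have hψd : ∀ y ∈ ψ.target, MDifferentiableAt 𝓘(ℝ, Plane) (𝓡 2) ψ.symm y := fun y hy ↦
    ((contMDiffOn_extChartAt_symm (n := 1) b).contMDiffAt
      ((isOpen_extChartAt_target b).mem_nhds hy)).mdifferentiableAt one_ne_zero
  have hφd : ∀ y ∈ φ.target, MDifferentiableAt 𝓘(ℝ, Plane) (𝓡 2) φ.symm y := fun y hy ↦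
    ((contMDiffOn_extChartAt_symm (n := 1) a).contMDiffAt
      ((isOpen_extChartAt_target a).mem_nhds hy)).mdifferentiableAt one_ne_zero
  have hfd : ∀ y ∈ ψ.target ∩ ψ.symm ⁻¹' s, MDifferentiableAt 𝓘(ℝ, Plane) 𝓘(ℝ, Plane) f y := by
    rintro y ⟨hy, hys⟩
    refine MDifferentiableAt.comp (I' := 𝓡 2) y ?_ (hψd y hy)
    exact mdifferentiableAt_extChartAt (by simpa [hφ] using ha hys)
  have hkey : ∀ y ∈ ψ.target ∩ ψ.symm ⁻¹' s,
      mfderiv 𝓘(ℝ, Plane) (𝓡 2) ψ.symm y =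
        (mfderiv 𝓘(ℝ, Plane) (𝓡 2) φ.symm (f y)).comp (fderiv ℝ f y) := by
    rintro y ⟨hy, hys⟩
    have hev : ψ.symm =ᶠ[nhds y] φ.symm ∘ f := by
      have h1 : ∀ᶠ z in nhds y, ψ.symm z ∈ φ.source :=
        (hψd y hy).continuousAt.preimage_mem_nhds ((isOpen_extChartAt_source a).mem_nhds (ha hys))
      filter_upwards [h1] with z hz
      simp [hf, φ.left_inv hz]
    rw [hev.mfderiv_eq, mfderiv_comp (I' := 𝓘(ℝ, Plane)) y
      (hφd _ (φ.map_source (ha hys))) (hfd y ⟨hy, hys⟩), mfderiv_eq_fderiv]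
    rfl
  have hdens : ∀ y ∈ ψ.target ∩ ψ.symm ⁻¹' s,
      (coeff g b y).det = (fderiv ℝ f y).det ^ 2 * (coeff g a (f y)).det := by
    rintro y ⟨hy, hys⟩
    set J : Matrix (Fin 2) (Fin 2) ℝ := LinearMap.toMatrix (EuclideanSpace.basisFun (Fin 2) ℝ).toBasis
      (EuclideanSpace.basisFun (Fin 2) ℝ).toBasis (fderiv ℝ f y : Plane →ₗ[ℝ] Plane) with hJ
    have hJdet : J.det = (fderiv ℝ f y).det := LinearMap.det_toMatrix _ _
    have hJv : ∀ i, fderiv ℝ f y (stdVec i) = ∑ k, J k i • stdVec k := by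
      intro i
      ext k
      simp [hJ, LinearMap.toMatrix_apply, stdVec, Fin.sum_univ_two, PiLp.single_apply]
      fin_cases k <;> simp
    have hG : coeff g b y = J.transpose * coeff g a (f y) * J := by
      have hpt : ψ.symm y = φ.symm (f y) := (φ.left_inv (ha hys)).symm
      have hin : ∀ p q : M, p = q → ∀ v w : Plane, g.inner p v w = g.inner q v w := by
        rintro p q rfl v w
        rfl
      have hkv : ∀ i, (mfderiv 𝓘(ℝ, Plane) (𝓡 2) ψ.symm y (stdVec i) : Plane) =
          ∑ k, J k i • (mfderiv 𝓘(ℝ, Plane) (𝓡 2) φ.symm (f y) (stdVec k) : Plane) := by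
        intro i
        have h := congrArg (fun T : Plane →L[ℝ] Plane ↦ T (stdVec i)) (hkey y ⟨hy, hys⟩)
        refine h.trans ?_
        refine (congrArg (mfderiv 𝓘(ℝ, Plane) (𝓡 2) φ.symm (f y)) (hJv i)).trans ?_
        have hlin : ∀ T : Plane →L[ℝ] Plane,
            T (∑ k, J k i • stdVec k) = ∑ k, J k i • T (stdVec k) := fun T ↦ by simp
        exact hlin _
      ext i j
      refine (hin _ _ hpt _ _).trans ?_
      rw [hkv i, hkv j]
      set B : Plane →L[ℝ] Plane →L[ℝ] ℝ := g.inner (φ.symm (f y)) with hB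
      set e : Fin 2 → Plane := fun k ↦ mfderiv 𝓘(ℝ, Plane) (𝓡 2) φ.symm (f y) (stdVec k) with he
      have hc : ∀ k l, coeff g a (f y) k l = B (e k) (e l) := fun k l ↦ rfl
      simp only [Matrix.mul_apply, Matrix.transpose_apply, hc, Fin.sum_univ_two]
      change B (J 0 i • e 0 + J 1 i • e 1) (J 0 j • e 0 + J 1 j • e 1) = _
      simp only [map_add, map_smul, add_apply, smul_apply, smul_eq_mul]
      ring
    rw [hG, Matrix.det_mul, Matrix.det_mul, Matrix.det_transpose, hJdet]
    ring
  unfold areaInChart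
  rw [← hφ, ← hψ, himg, lintegral_image_eq_lintegral_abs_det_fderiv_mul volume
    (measurableSet_chart b hs) (fun y hy ↦ ((hfd y hy).differentiableAt.hasFDerivAt).hasFDerivWithinAt) hinj]
  refine setLIntegral_congr_fun (measurableSet_chart b hs) fun y hy ↦ ?_
  rw [hdens y hy, Real.sqrt_mul (sq_nonneg _), Real.sqrt_sq_eq_abs, ENNReal.ofReal_mul (abs_nonneg _)]

end

/-- Countably many charts cover a closed surface. -/
theorem exists_chart_cover (M : Type*) [TopologicalSpace M] [ChartedSpace Plane M]
    [CompactSpace M] [Nonempty M] :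
    ∃ c : ℕ → M, ⋃ n, (chartAt Plane (c n)).source = univ := by
  obtain ⟨s, hs, hsu⟩ := countable_cover_nhds_of_sigmaCompact
    (fun x : M ↦ chart_source_mem_nhds Plane x)
  have hne : s.Nonempty := by
    by_contra h
    rw [not_nonempty_iff_eq_empty] at h
    simp [h] at hsu
    exact (univ_nonempty (α := M)).ne_empty hsu.symm
  obtain ⟨c, rfl⟩ := hs.exists_eq_range hne
  exact ⟨c, by simpa [biUnion_range] using hsu⟩

section

variable {M : Type*} [TopologicalSpace M] [ChartedSpace Plane M] [IsManifold (𝓡 2) ∞ M]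
  [CompactSpace M] [Nonempty M]

variable (M) in
/-- Base points of a sequence of charts covering the surface. -/
def chartCenter : ℕ → M := (exists_chart_cover M).choose

variable (M) in
/-- The surface cut into disjoint Borel pieces, the `n`-th of which lies in the `n`-th chart of the
covering: the chart domain minus the previous chart domains. -/
def piece : ℕ → Set M := disjointed fun n ↦ (chartAt Plane (chartCenter M n)).source

/-- The `g`-area (Riemannian measure) of a Borel set. By the change of variables formula
it does not depend on the covering by charts, see `area_eq_areaInChart`. -/
def area (g : Metric M) (s : Set M) : ℝ≥0∞ :=
  ∑' n, areaInChart g (chartCenter M n) (s ∩ piece M n)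

/-- The area is independent of the covering: on any chart domain it is the integral of `√(det G)`. -/
theorem area_eq_areaInChart [MeasurableSpace M] [BorelSpace M] (g : Metric M) (c : M)
    {s : Set M} (hs : MeasurableSet s) (hc : s ⊆ (chartAt Plane c).source) :
    area g s = areaInChart g c s := by
  have hp : ∀ n, MeasurableSet (piece M n) := fun n ↦
    MeasurableSet.disjointed (fun n ↦ (chartAt Plane (chartCenter M n)).open_source.measurableSet) n
  have hU : ⋃ n, piece M n = univ := by
    rw [piece, iUnion_disjointed]
    exact (exists_chart_cover M).choose_spec
  have h1 : ∀ n, areaInChart g (chartCenter M n) (s ∩ piece M n) = areaInChart g c (s ∩ piece M n) :=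
    fun n ↦ areaInChart_congr g _ _ (hs.inter (hp n))
      (inter_subset_right.trans (disjointed_subset _ n)) (inter_subset_left.trans hc)
  rw [area, tsum_congr h1]
  unfold areaInChart
  rw [← lintegral_iUnion (fun n ↦ measurableSet_chart c (hs.inter (hp n)))]
  · congr 2
    rw [← inter_iUnion, ← preimage_iUnion, ← inter_iUnion, hU, inter_univ]
  · intro m n hmn
    have := disjoint_disjointed (fun n ↦ (chartAt Plane (chartCenter M n)).source) hmn
    refine Set.disjoint_left.2 fun y hy hy' ↦ ?_
    exact Set.disjoint_left.1 this hy.2.2 hy'.2.2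

/-- The total area of `(M, g)`. -/
def totalArea (g : Metric M) : ℝ≥0∞ := area g univ

end

end Surface

end

/-! In dimension two a point has zero capacity: a bump function can equal 1 at a point, vanish
outside a fixed disc, and have arbitrarily small Dirichlet energy
(`exists_bump_integral_energy_le`). Such a bump is scaled to a function H, supported in a chart disc
around p, with H(p) = 3D and still very small energy.

On the disc σ is comparable to the Euclidean metric with a constant C (`exists_chart_bounds`). Take
(1 + C|∇H|²)σ, with the Euclidean gradient and the factor 1 off the chart. For this metric H is
1-Lipschitz, so p is at distance at least 3D from the edge of the disc (`ofReal_sub_le_gdist`). Area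
is linear in a conformal factor on a surface, so it grows only by a multiple of the energy, and the
new area is at most 4A (`totalArea_conformalChange_one_add_le`). Rescaling to area A multiplies
lengths by at least 1/2, which leaves a distance of at least 3D/2 > D. -/

namespace Surface

open Topology

/-! ### Dirichlet energy in the plane and the zero capacity of a point -/

/-- The squared Euclidean norm of the gradient of a function on the plane. -/
noncomputable def energy (f : Plane → ℝ) (y : Plane) : ℝ := ∑ i, pderiv i f y ^ 2

theorem energy_nonneg (f : Plane → ℝ) (y : Plane) : 0 ≤ energy f y :=
  Finset.sum_nonneg fun _ _ ↦ sq_nonneg _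

theorem contDiff_energy {f : Plane → ℝ} (hf : ContDiff ℝ ∞ f) : ContDiff ℝ ∞ (energy f) := by
  unfold energy pderiv
  refine ContDiff.sum fun i _ ↦ ContDiff.pow ?_ 2
  exact (hf.fderiv_right (m := ∞) (by simp)).clm_apply contDiff_const

/-- Cauchy–Schwarz for ∇f and w; the square handed to `nlinarith` is the defect in Lagrange's
identity. -/
theorem sq_fderiv_le_energy (f : Plane → ℝ) (y w : Plane) :
    (fderiv ℝ f y w) ^ 2 ≤ energy f y * ‖w‖ ^ 2 := by
  have hw : w = w 0 • stdVec 0 + w 1 • stdVec 1 := by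
    ext k
    fin_cases k <;> simp [stdVec]
  have h1 : fderiv ℝ f y w = w 0 * pderiv 0 f y + w 1 * pderiv 1 f y := by
    conv_lhs => rw [hw]
    simp [pderiv]
  rw [h1, energy, EuclideanSpace.norm_sq_eq]
  simp only [Fin.sum_univ_two, Real.norm_eq_abs, sq_abs]
  nlinarith [sq_nonneg (w 0 * pderiv 1 f y - w 1 * pderiv 0 f y)]

theorem energy_eq_zero_of_eventuallyEq_const {f : Plane → ℝ} {y : Plane} {a : ℝ}
    (h : f =ᶠ[𝓝 y] fun _ ↦ a) : energy f y = 0 := by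
  simp [energy, pderiv, h.fderiv_eq]

theorem energy_comp_sub (f : Plane → ℝ) (c y : Plane) :
    energy (fun z ↦ f (z - c)) y = energy f (y - c) := by
  simp [energy, pderiv, fderiv_comp_sub]

theorem energy_const_mul (f : Plane → ℝ) (a : ℝ) (y : Plane) :
    energy (fun z ↦ a * f z) y = a ^ 2 * energy f y := by
  have : fderiv ℝ (fun z ↦ a * f z) y = a • fderiv ℝ f y := by
    exact congrFun (fderiv_const_smul_field (𝕜 := ℝ) (f := f) a) y
  simp [energy, pderiv, this, mul_pow, mul_add]

theorem energy_comp_smul (f : Plane → ℝ) (a : ℝ) (y : Plane) :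
    energy (fun z ↦ f (a • z)) y = a ^ 2 * energy f (a • y) := by
  have : fderiv ℝ (fun z ↦ f (a • z)) y = a • fderiv ℝ f (a • y) := fderiv_comp_smul a
  simp [energy, pderiv, this, mul_pow, mul_add]

/-- Dirichlet energy is scale invariant exactly in dimension two: the factor a² from the gradient
cancels the Jacobian a⁻². This is what makes the capacity of a point vanish. -/
theorem integral_energy_comp_smul (f : Plane → ℝ) {a : ℝ} (ha : a ≠ 0) :
    ∫ y, energy (fun z ↦ f (a • z)) y = ∫ y, energy f y := by
  simp_rw [energy_comp_smul, integral_const_mul, Measure.integral_comp_smul]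
  have ha2 : (0 : ℝ) < a ^ 2 := by positivity
  simp only [finrank_euclideanSpace, Fintype.card_fin, smul_eq_mul, abs_inv, abs_of_pos ha2]
  field_simp

/-- The energy of a sum of functions with pairwise disjointly supported gradients. -/
theorem energy_sum {ι : Type*} (s : Finset ι) (f : ι → Plane → ℝ)
    (hf : ∀ k ∈ s, Differentiable ℝ (f k)) (y : Plane)
    (h : ∀ k ∈ s, ∀ l ∈ s, k ≠ l → energy (f k) y = 0 ∨ energy (f l) y = 0) :
    energy (fun z ↦ ∑ k ∈ s, f k z) y = ∑ k ∈ s, energy (f k) y := by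
  by_cases h0 : ∀ k ∈ s, energy (f k) y = 0
  · have hz : ∀ k ∈ s, ∀ i, pderiv i (f k) y = 0 := by
      intro k hk i
      have := (Finset.sum_eq_zero_iff_of_nonneg (fun _ _ ↦ sq_nonneg _)).1 (h0 k hk) i
        (Finset.mem_univ i)
      simpa using this
    rw [Finset.sum_eq_zero h0]
    refine Finset.sum_eq_zero fun i _ ↦ ?_
    have : pderiv i (fun z ↦ ∑ k ∈ s, f k z) y = ∑ k ∈ s, pderiv i (f k) y := by
      simp [pderiv, fderiv_fun_sum fun k hk ↦ (hf k hk).differentiableAt]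
    rw [this, Finset.sum_eq_zero fun k hk ↦ hz k hk i]
    simp
  · push Not at h0
    obtain ⟨k, hk, hk0⟩ := h0
    have hl : ∀ l ∈ s, l ≠ k → energy (f l) y = 0 := fun l hl hlk ↦
      (h l hl k hk hlk).resolve_right hk0
    have hz : ∀ l ∈ s, l ≠ k → ∀ i, pderiv i (f l) y = 0 := by
      intro l hls hlk i
      have := (Finset.sum_eq_zero_iff_of_nonneg (fun _ _ ↦ sq_nonneg _)).1 (hl l hls hlk) i
        (Finset.mem_univ i)
      simpa using this
    rw [Finset.sum_eq_single_of_mem k hk hl]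
    refine Finset.sum_congr rfl fun i _ ↦ ?_
    have : pderiv i (fun z ↦ ∑ k ∈ s, f k z) y = ∑ k ∈ s, pderiv i (f k) y := by
      simp [pderiv, fderiv_fun_sum fun k hk ↦ (hf k hk).differentiableAt]
    rw [this, Finset.sum_eq_single_of_mem k hk fun l hl hlk ↦ hz l hl hlk i]

theorem integrable_energy {f : Plane → ℝ} (hf : ContDiff ℝ ∞ f) (hs : HasCompactSupport f) :
    Integrable (energy f) := by
  refine (contDiff_energy hf).continuous.integrable_of_hasCompactSupport ?_
  refine hs.mono' fun y hy ↦ ?_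
  by_contra hn
  exact hy (energy_eq_zero_of_eventuallyEq_const (notMem_tsupport_iff_eventuallyEq.1 hn))

/-- A point of the plane has zero capacity: there are bump functions of arbitrarily small Dirichlet
energy around it. -/
theorem exists_bump_integral_energy_le (c : Plane) {R ε : ℝ} (hR : 0 < R) (hε : 0 < ε) :
    ∃ f : Plane → ℝ, ContDiff ℝ ∞ f ∧ f c = 1 ∧ (∀ y ∉ Metric.ball c R, f y = 0) ∧
      ∫ y, energy f y ≤ ε := by
  let ψ : ContDiffBump (0 : Plane) := ⟨R / 2, R, by positivity, by linarith⟩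
  have hψ : ContDiff ℝ ∞ ψ := ψ.contDiff
  have hψ0 : ∀ y : Plane, R ≤ ‖y‖ → ψ y = 0 := fun y hy ↦
    ψ.zero_of_le_dist (by simpa [ψ] using hy)
  have hE1 : ∀ y : Plane, ‖y‖ < R / 2 → energy ψ y = 0 := by
    intro y hy
    refine energy_eq_zero_of_eventuallyEq_const (a := 1) ?_
    filter_upwards [Metric.isOpen_ball.mem_nhds (show y ∈ Metric.ball 0 (R / 2) by simpa using hy)]
      with z hz
    exact ψ.one_of_mem_closedBall (Metric.ball_subset_closedBall hz)
  have hE2 : ∀ y : Plane, R < ‖y‖ → energy ψ y = 0 := by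
    intro y hy
    refine energy_eq_zero_of_eventuallyEq_const (a := 0) ?_
    filter_upwards [(isOpen_lt continuous_const continuous_norm).mem_nhds hy] with z hz
    exact hψ0 z (le_of_lt hz)
  -- The bump is the average of N rescaled copies of ψ, each of the same energy E. When their
  -- gradients are disjointly supported, the average has energy N · E / N² = E / N.
  obtain ⟨N, hN⟩ := exists_nat_gt ((∫ y, energy ψ y) / ε)
  have hI : 0 ≤ ∫ y, energy ψ y := integral_nonneg fun y ↦ energy_nonneg _ _
  have hN0 : (0 : ℝ) < N := lt_of_le_of_lt (by positivity) hN
  -- The gradient of `F k` lives in the annulus R/2 ≤ 4ᵏ‖y‖ ≤ R. The ratio 4 exceeds the ratio 2 of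
  -- the radii, so distinct annuli are disjoint.
  let F : ℕ → Plane → ℝ := fun k y ↦ ψ ((4 : ℝ) ^ k • y)
  have hF : ∀ k, ContDiff ℝ ∞ (F k) := fun k ↦ hψ.comp (contDiff_id.const_smul _)
  have hFs : ∀ k y, R ≤ ‖y‖ → F k y = 0 := by
    intro k y hy
    refine hψ0 _ ?_
    rw [norm_smul, Real.norm_of_nonneg (by positivity)]
    have : (1 : ℝ) ≤ 4 ^ k := one_le_pow₀ (by norm_num)
    nlinarith
  have hFc : ∀ k, HasCompactSupport (F k) := fun k ↦
    HasCompactSupport.intro (isCompact_closedBall (0 : Plane) R) fun y hy ↦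
      hFs k y (by simpa using (not_le.1 (by simpa using hy)).le)
  have hdisj : ∀ y, ∀ k l, k < l → energy (F k) y = 0 ∨ energy (F l) y = 0 := by
    intro y k l hkl
    simp only [F, energy_comp_smul]
    by_cases hy : ‖(4 : ℝ) ^ k • y‖ < R / 2
    · exact Or.inl (by rw [hE1 _ hy, mul_zero])
    · right
      rw [hE2, mul_zero]
      rw [norm_smul, Real.norm_of_nonneg (by positivity)] at hy ⊢
      have h4 : (4 : ℝ) ^ (k + 1) ≤ 4 ^ l := pow_le_pow_right₀ (by norm_num) hkl
      rw [pow_succ] at h4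
      have := mul_le_mul_of_nonneg_right h4 (norm_nonneg y)
      linarith
  refine ⟨fun y ↦ (N : ℝ)⁻¹ * ∑ k ∈ Finset.range N, F k (y - c), ?_, ?_, ?_, ?_⟩
  · exact contDiff_const.mul
      (ContDiff.sum fun k _ ↦ (hF k).comp (contDiff_id.sub contDiff_const))
  · have h1 : ∀ k, F k 0 = 1 := fun k ↦ by
      simpa [F] using ψ.one_of_mem_closedBall (x := 0) (by simp [ψ]; positivity)
    simp [h1, hN0.ne']
  · intro y hy
    have : R ≤ ‖y - c‖ := by simpa [dist_eq_norm] using hy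
    simp [hFs _ _ this]
  · have : ∀ y, energy (fun y ↦ (N : ℝ)⁻¹ * ∑ k ∈ Finset.range N, F k (y - c)) y =
        ((N : ℝ)⁻¹) ^ 2 * ∑ k ∈ Finset.range N, energy (F k) (y - c) := by
      intro y
      rw [energy_const_mul, energy_comp_sub (fun z ↦ ∑ k ∈ Finset.range N, F k z),
        energy_sum _ _ fun k _ ↦ (hF k).differentiable (by simp)]
      intro k _ l _ hkl
      rcases lt_or_gt_of_ne hkl with h | h
      · exact hdisj _ k l h
      · exact (hdisj _ l k h).symm
    simp_rw [this, integral_const_mul]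
    rw [integral_sub_right_eq_self (fun y ↦ ∑ k ∈ Finset.range N, energy (F k) y),
      integral_finsetSum _ fun k _ ↦ integrable_energy (hF k) (hFc k),
      Finset.sum_congr rfl fun k _ ↦ integral_energy_comp_smul ψ (a := (4 : ℝ) ^ k) (by positivity)]
    rw [Finset.sum_const, Finset.card_range, nsmul_eq_mul]
    rw [div_lt_iff₀ hε] at hN
    field_simp
    linarith

/-! ### Conformal changes and their effect on area -/

section

variable {M : Type*} [TopologicalSpace M] [ChartedSpace Plane M] [IsManifold (𝓡 2) ∞ M]

set_option synthInstance.maxHeartbeats 200000 in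
/-- The metric `f σ`, for a smooth positive function `f`. -/
noncomputable def conformalChange (σ : Metric M) (f : M → ℝ)
    (hf : ContMDiff (𝓡 2) 𝓘(ℝ, ℝ) ∞ f) (hpos : ∀ x, 0 < f x) : Metric M where
  inner x := f x • σ.inner x
  symm x v w := by
    change f x * σ.inner x v w = f x * σ.inner x w v
    rw [σ.symm]
  pos x v hv := mul_pos (hpos x) (σ.pos x v hv)
  isVonNBounded x := by
    -- The unit ball of fσ is that of σ shrunk by the factor 1/√f.
    have h := (σ.isVonNBounded x).image
      ((√(f x))⁻¹ • ContinuousLinearMap.id ℝ (TangentSpace (𝓡 2) x))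
    refine h.subset ?_
    intro v hv
    have hv' : f x * σ.inner x v v < 1 := hv
    refine (mem_image _ _ _).2 ⟨√(f x) • v, ?_, ?_⟩
    · have : σ.inner x (√(f x) • v) (√(f x) • v) = f x * σ.inner x v v := by
        rw [map_smul, map_smul]
        change √(f x) * (√(f x) * σ.inner x v v) = _
        rw [← mul_assoc, Real.mul_self_sqrt (hpos x).le]
      change σ.inner x (√(f x) • v) (√(f x) • v) < 1
      rwa [this]
    · change (√(f x))⁻¹ • √(f x) • v = v
      exact inv_smul_smul₀ (Real.sqrt_pos.2 (hpos x)).ne' v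
  contMDiff := hf.smul_section σ.contMDiff

theorem conformalChange_inner (σ : Metric M) (f : M → ℝ)
    (hf : ContMDiff (𝓡 2) 𝓘(ℝ, ℝ) ∞ f) (hpos : ∀ x, 0 < f x) (x : M)
    (v w : TangentSpace (𝓡 2) x) :
    (conformalChange σ f hf hpos).inner x v w = f x * σ.inner x v w := rfl

theorem isConformal_conformalChange (σ : Metric M) (f : M → ℝ)
    (hf : ContMDiff (𝓡 2) 𝓘(ℝ, ℝ) ∞ f) (hpos : ∀ x, 0 < f x) :
    IsConformal (conformalChange σ f hf hpos) σ := by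
  refine ⟨fun x ↦ 1 / 2 * Real.log (f x), fun x ↦ ?_, fun x v w ↦ ?_⟩
  · have h : ContDiffAt ℝ ∞ (fun t : ℝ ↦ 1 / 2 * Real.log t) (f x) :=
      contDiffAt_const.mul (Real.contDiffAt_log.2 (hpos x).ne')
    exact h.contMDiffAt.comp x (hf x)
  · rw [conformalChange_inner, ← mul_assoc]
    rw [mul_one_div_cancel two_ne_zero, one_mul,
      Real.exp_log (hpos x)]

/-- Lets σ itself enter comparisons between two conformal changes. -/
theorem conformalChange_one (σ : Metric M) :
    conformalChange σ (fun _ ↦ 1) contMDiff_const (fun _ ↦ one_pos) = σ := by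
  cases σ
  simp [conformalChange]

theorem coeff_conformalChange (σ : Metric M) (f : M → ℝ)
    (hf : ContMDiff (𝓡 2) 𝓘(ℝ, ℝ) ∞ f) (hpos : ∀ x, 0 < f x) (c : M) (y : Plane) :
    coeff (conformalChange σ f hf hpos) c y =
      f ((extChartAt (𝓡 2) c).symm y) • coeff σ c y := rfl

/-- For 2 × 2 matrices the determinant scales by f², so the area density scales by f itself. -/
theorem areaInChart_conformalChange (σ : Metric M) (f : M → ℝ)
    (hf : ContMDiff (𝓡 2) 𝓘(ℝ, ℝ) ∞ f) (hpos : ∀ x, 0 < f x) (c : M) (s : Set M) :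
    areaInChart (conformalChange σ f hf hpos) c s =
      ∫⁻ y in (extChartAt (𝓡 2) c).target ∩ (extChartAt (𝓡 2) c).symm ⁻¹' s,
        ENNReal.ofReal (f ((extChartAt (𝓡 2) c).symm y)) *
          ENNReal.ofReal (√(coeff σ c y).det) := by
  unfold areaInChart
  refine lintegral_congr fun y ↦ ?_
  rw [coeff_conformalChange, Matrix.det_smul, Fintype.card_fin, Real.sqrt_mul (sq_nonneg _),
    Real.sqrt_sq (hpos _).le, ENNReal.ofReal_mul (hpos _).le]

theorem areaInChart_inter_add_diff [MeasurableSpace M] [BorelSpace M] (g : Metric M) (c : M)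
    (s : Set M) {t : Set M} (ht : MeasurableSet t) :
    areaInChart g c (s ∩ t) + areaInChart g c (s \ t) = areaInChart g c s := by
  set φ := extChartAt (𝓡 2) c with hφ
  have h1 : φ.target ∩ φ.symm ⁻¹' (s ∩ t) =
      (φ.target ∩ φ.symm ⁻¹' s) ∩ (φ.target ∩ φ.symm ⁻¹' t) := by
    rw [preimage_inter, inter_inter_distrib_left]
  have h2 : φ.target ∩ φ.symm ⁻¹' (s \ t) =
      (φ.target ∩ φ.symm ⁻¹' s) \ (φ.target ∩ φ.symm ⁻¹' t) := by
    ext y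
    simp only [mem_inter_iff, mem_preimage, mem_sdiff]
    tauto
  unfold areaInChart
  rw [← hφ, h1, h2]
  exact lintegral_inter_add_sdiff _ _ (measurableSet_chart c ht)

variable [CompactSpace M] [Nonempty M]

theorem area_inter_add_diff [MeasurableSpace M] [BorelSpace M] (g : Metric M)
    (s : Set M) {t : Set M} (ht : MeasurableSet t) :
    area g (s ∩ t) + area g (s \ t) = area g s := by
  unfold area
  rw [← ENNReal.tsum_add]
  refine tsum_congr fun n ↦ ?_
  rw [← areaInChart_inter_add_diff g _ (s ∩ piece M n) ht, inter_right_comm,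
    inter_sdiff_right_comm]

theorem area_conformalChange_congr (σ : Metric M) (f f' : M → ℝ)
    (hf : ContMDiff (𝓡 2) 𝓘(ℝ, ℝ) ∞ f) (hpos : ∀ x, 0 < f x)
    (hf' : ContMDiff (𝓡 2) 𝓘(ℝ, ℝ) ∞ f') (hpos' : ∀ x, 0 < f' x)
    [MeasurableSpace M] [BorelSpace M] {s : Set M} (hs : MeasurableSet s) (h : EqOn f f' s) :
    area (conformalChange σ f hf hpos) s = area (conformalChange σ f' hf' hpos') s := by
  unfold area
  refine tsum_congr fun n ↦ ?_
  have hp : MeasurableSet (piece M n) :=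
    MeasurableSet.disjointed (fun n ↦ (chartAt Plane (chartCenter M n)).open_source.measurableSet) n
  rw [areaInChart_conformalChange, areaInChart_conformalChange]
  refine setLIntegral_congr_fun (measurableSet_chart _ (hs.inter hp)) fun y hy ↦ ?_
  simp only [h hy.2.1]

theorem totalArea_conformalChange_const_mul (σ : Metric M) (f : M → ℝ) (a : ℝ) (ha : 0 < a)
    (hf : ContMDiff (𝓡 2) 𝓘(ℝ, ℝ) ∞ f) (hpos : ∀ x, 0 < f x)
    (hf' : ContMDiff (𝓡 2) 𝓘(ℝ, ℝ) ∞ fun x ↦ a * f x) :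
    totalArea (conformalChange σ (fun x ↦ a * f x) hf' fun x ↦ mul_pos ha (hpos x)) =
      ENNReal.ofReal a * totalArea (conformalChange σ f hf hpos) := by
  unfold totalArea area
  rw [← ENNReal.tsum_mul_left]
  refine tsum_congr fun n ↦ ?_
  rw [areaInChart_conformalChange, areaInChart_conformalChange,
    ← lintegral_const_mul' _ _ ENNReal.ofReal_ne_top]
  refine lintegral_congr fun y ↦ ?_
  rw [ENNReal.ofReal_mul ha.le, mul_assoc]

end

/-! ### Lower bounds for the Riemannian distance -/

section

variable {M : Type*} [TopologicalSpace M] [ChartedSpace Plane M] [IsManifold (𝓡 2) ∞ M]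

/-- A function with differential of norm at most one is `1`-Lipschitz for the Riemannian distance. -/
theorem ofReal_sub_le_gdist (g : Metric M) {F : M → ℝ} (hF : ContMDiff (𝓡 2) 𝓘(ℝ, ℝ) 1 F)
    (hle : ∀ (x : M) (v : TangentSpace (𝓡 2) x) (a : ℝ),
      a = mfderiv (𝓡 2) 𝓘(ℝ, ℝ) F x v → a ^ 2 ≤ g.inner x v v) (x y : M) :
    ENNReal.ofReal (F y - F x) ≤ gdist g x y := by
  unfold gdist
  let _ : RiemannianBundle (fun x : M ↦ TangentSpace (𝓡 2) x) := ⟨g.toRiemannianMetric⟩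
  -- Along any path of length less than r, F changes by at most the integral of |(F ∘ γ)'|, and
  -- pointwise this is at most the speed of γ.
  refine le_of_forall_gt fun r hr ↦ ?_
  obtain ⟨γ, hγ0, hγ1, hγ, hlen⟩ := exists_lt_of_riemannianEDist_lt hr
  refine lt_of_le_of_lt ?_ hlen
  have hD : ContDiffOn ℝ 1 (F ∘ γ) (Icc 0 1) :=
    contMDiffOn_iff_contDiffOn.1 (hF.comp_contMDiffOn hγ)
  have h1 : ENNReal.ofReal (F y - F x) ≤ ‖(F ∘ γ) 1 - (F ∘ γ) 0‖ₑ := by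
    rw [Function.comp_apply, Function.comp_apply, hγ0, hγ1]
    exact Real.ofReal_le_enorm _
  refine h1.trans ((enorm_sub_le_lintegral_derivWithin_Icc_of_contDiffOn_Icc hD
    zero_le_one).trans ?_)
  rw [pathELength_eq_lintegral_mfderivWithin_Icc]
  refine setLIntegral_mono' measurableSet_Icc fun t ht ↦ ?_
  set v : TangentSpace (𝓡 2) (γ t) := mfderivWithin 𝓘(ℝ, ℝ) (𝓡 2) γ (Icc 0 1) t 1 with hv
  have h2 : derivWithin (F ∘ γ) (Icc 0 1) t = mfderiv (𝓡 2) 𝓘(ℝ, ℝ) F (γ t) v := by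
    rw [← fderivWithin_derivWithin, ← mfderivWithin_eq_fderivWithin]
    have hu : UniqueMDiffWithinAt 𝓘(ℝ, ℝ) (Icc (0 : ℝ) 1) t :=
      uniqueMDiffWithinAt_iff_uniqueDiffWithinAt.2 (uniqueDiffOn_Icc zero_lt_one t ht)
    rw [mfderiv_comp_mfderivWithin t (I' := 𝓡 2) ((hF (γ t)).mdifferentiableAt one_ne_zero)
      ((hγ t ht).mdifferentiableWithinAt one_ne_zero) hu]
    rfl
  have h3 : ‖v‖ = √(g.inner (γ t) v v) := norm_eq_sqrt_real_inner v
  rw [← enorm_norm v, h3, Real.enorm_eq_ofReal_abs, Real.enorm_eq_ofReal_abs,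
    abs_of_nonneg (Real.sqrt_nonneg _)]
  exact ENNReal.ofReal_le_ofReal (Real.abs_le_sqrt (hle _ _ _ h2))

end

/-! ### Comparison of a metric with the Euclidean metric of a chart -/

section

variable {M : Type*} [TopologicalSpace M] [ChartedSpace Plane M] [IsManifold (𝓡 2) ∞ M]

section

attribute [local instance] normedAddCommGroupTangentSpaceVectorSpace
  normedSpaceTangentSpaceVectorSpace

/-- Continuity of the metric bounds the operator norm of the chart differential near p. Naming the
image w as a vector of `Plane` makes its norm the Euclidean one. -/
theorem eventually_norm_sq_mfderiv_extChartAt_le (g : Metric M) (p : M) :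
    ∃ C > 0, ∀ᶠ x in 𝓝 p, ∀ (v : TangentSpace (𝓡 2) x) (w : Plane),
      w = mfderiv (𝓡 2) 𝓘(ℝ, Plane) (extChartAt (𝓡 2) p) x v → ‖w‖ ^ 2 ≤ C * g.inner x v v := by
  let _ : RiemannianBundle (fun x : M ↦ TangentSpace (𝓡 2) x) := ⟨g.toRiemannianMetric⟩
  have : IsManifold (𝓡 2) 1 M := .of_le (n := ∞) (by simp)
  have : IsContinuousRiemannianBundle Plane (fun x : M ↦ TangentSpace (𝓡 2) x) :=
    ⟨⟨g.inner, g.contMDiff.continuous, fun _ _ _ ↦ rfl⟩⟩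
  obtain ⟨C, hC, h⟩ := eventually_norm_mfderiv_extChartAt_lt (𝓡 2) p
  refine ⟨C ^ 2, by positivity, ?_⟩
  filter_upwards [h] with x hx v w hw
  have h1 : ‖w‖ ≤ C * ‖v‖ := by
    rw [hw]
    exact (ContinuousLinearMap.le_opNorm _ v).trans
      (mul_le_mul_of_nonneg_right hx.le (norm_nonneg v))
  have h2 : ‖v‖ ^ 2 = g.inner x v v := (real_inner_self_eq_norm_sq v).symm
  rw [← h2, ← mul_pow]
  exact pow_le_pow_left₀ (norm_nonneg _) h1 2

/-- The reverse comparison, from the same local bound for the inverse chart. -/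
theorem eventually_inner_mfderiv_extChartAt_symm_le (g : Metric M) (p : M) :
    ∃ C > 0, ∀ᶠ y in 𝓝 (extChartAt (𝓡 2) p p),
      ∀ (w : Plane) (v : TangentSpace (𝓡 2) ((extChartAt (𝓡 2) p).symm y)),
      v = mfderiv 𝓘(ℝ, Plane) (𝓡 2) (extChartAt (𝓡 2) p).symm y w →
        g.inner ((extChartAt (𝓡 2) p).symm y) v v ≤ C * ‖w‖ ^ 2 := by
  let _ : RiemannianBundle (fun x : M ↦ TangentSpace (𝓡 2) x) := ⟨g.toRiemannianMetric⟩
  have : IsManifold (𝓡 2) 1 M := .of_le (n := ∞) (by simp)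
  have : IsContinuousRiemannianBundle Plane (fun x : M ↦ TangentSpace (𝓡 2) x) :=
    ⟨⟨g.inner, g.contMDiff.continuous, fun _ _ _ ↦ rfl⟩⟩
  obtain ⟨C, hC, h⟩ := eventually_norm_mfderivWithin_symm_extChartAt_lt (𝓡 2) p
  simp only [modelWithCornersSelf_coe, range_id, nhdsWithin_univ, mfderivWithin_univ] at h
  refine ⟨C ^ 2, by positivity, ?_⟩
  filter_upwards [h] with y hy w v hv
  have h1 : ‖v‖ ≤ C * ‖w‖ := by
    rw [hv]
    exact (ContinuousLinearMap.le_opNorm _ _).trans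
      (mul_le_mul_of_nonneg_right hy.le (norm_nonneg w))
  have h2 : ‖v‖ ^ 2 = g.inner ((extChartAt (𝓡 2) p).symm y) v v :=
    (real_inner_self_eq_norm_sq v).symm
  rw [← h2, ← mul_pow]
  exact pow_le_pow_left₀ (norm_nonneg _) h1 2

end

theorem coeff_symm (g : Metric M) (p : M) (y : Plane) (i j : Fin 2) :
    coeff g p y i j = coeff g p y j i := g.symm _ _ _

/-- The quadratic form defined by the coefficients of a metric. -/
theorem inner_mfderiv_eq_coeff (g : Metric M) (p : M) (y w : Plane)
    (v : TangentSpace (𝓡 2) ((extChartAt (𝓡 2) p).symm y))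
    (hv : v = mfderiv 𝓘(ℝ, Plane) (𝓡 2) (extChartAt (𝓡 2) p).symm y w) :
    g.inner ((extChartAt (𝓡 2) p).symm y) v v =
      w 0 ^ 2 * coeff g p y 0 0 + 2 * (w 0 * w 1) * coeff g p y 0 1
        + w 1 ^ 2 * coeff g p y 1 1 := by
  subst hv
  have hw : w = w 0 • stdVec 0 + w 1 • stdVec 1 := by
    ext k
    fin_cases k <;> simp [stdVec]
  have hs := coeff_symm g p y 1 0
  let T : Plane →L[ℝ] Plane := mfderiv 𝓘(ℝ, Plane) (𝓡 2) (extChartAt (𝓡 2) p).symm y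
  let B : Plane →L[ℝ] Plane →L[ℝ] ℝ := g.inner ((extChartAt (𝓡 2) p).symm y)
  have hc : ∀ k l, coeff g p y k l = B (T (stdVec k)) (T (stdVec l)) := fun k l ↦ rfl
  change B (T w) (T w) = _
  rw [hc, hc] at hs
  rw [hc, hc, hc]
  conv_lhs => rw [hw]
  simp only [map_add, map_smul, add_apply, smul_apply, smul_eq_mul]
  rw [hs]
  ring

/-- Near the centre of a chart, a metric is comparable to the Euclidean metric of the chart. -/
theorem exists_chart_bounds (g : Metric M) (p : M) :
    ∃ C > 0, ∃ R > 0, Metric.closedBall (extChartAt (𝓡 2) p p) R ⊆ (extChartAt (𝓡 2) p).target ∧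
      (∀ x ∈ (extChartAt (𝓡 2) p).source,
        extChartAt (𝓡 2) p x ∈ Metric.closedBall (extChartAt (𝓡 2) p p) R →
        ∀ (v : TangentSpace (𝓡 2) x) (w : Plane),
        w = mfderiv (𝓡 2) 𝓘(ℝ, Plane) (extChartAt (𝓡 2) p) x v → ‖w‖ ^ 2 ≤ C * g.inner x v v) ∧
      ∀ y ∈ Metric.closedBall (extChartAt (𝓡 2) p p) R,
        √(coeff g p y).det ≤ C ∧ C⁻¹ ≤ √(coeff g p y).det := by
  obtain ⟨C₁, hC₁, h₁⟩ := eventually_norm_sq_mfderiv_extChartAt_le g p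
  obtain ⟨C₂, hC₂, h₂⟩ := eventually_inner_mfderiv_extChartAt_symm_le g p
  set φ := extChartAt (𝓡 2) p with hφ
  have h₁' : ∀ᶠ y in 𝓝 (φ p), ∀ (v : TangentSpace (𝓡 2) (φ.symm y)) (w : Plane),
      w = mfderiv (𝓡 2) 𝓘(ℝ, Plane) φ (φ.symm y) v → ‖w‖ ^ 2 ≤ C₁ * g.inner (φ.symm y) v v := by
    have hc : ContinuousAt φ.symm (φ p) := continuousAt_extChartAt_symm p
    refine hc.eventually (p := fun x ↦ ∀ (v : TangentSpace (𝓡 2) x) (w : Plane),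
      w = mfderiv (𝓡 2) 𝓘(ℝ, Plane) φ x v → ‖w‖ ^ 2 ≤ C₁ * g.inner x v v) ?_
    rw [extChartAt_to_inv]
    exact h₁
  obtain ⟨R, hR, hball⟩ := Metric.nhds_basis_closedBall.mem_iff.1
    (Filter.inter_mem (extChartAt_target_mem_nhds p) (Filter.inter_mem h₁' h₂))
  refine ⟨max C₁ C₂, lt_max_of_lt_left hC₁, R, hR, fun y hy ↦ (hball hy).1, ?_, ?_⟩
  · intro x hx hxR v w hw
    have := (hball hxR).2.1
    simp only [mem_ofPred_eq] at this
    rw [φ.left_inv hx] at this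
    have hpos : 0 ≤ g.inner x v v := by
      by_cases hv : v = 0
      · simp [hv]
      · exact (g.pos x v hv).le
    exact (this v w hw).trans (mul_le_mul_of_nonneg_right (le_max_left _ _) hpos)
  · intro y hy
    obtain ⟨hyt, hy1, hy2⟩ := hball hy
    set T : Plane →L[ℝ] Plane := mfderiv 𝓘(ℝ, Plane) (𝓡 2) φ.symm y with hT
    have hinv : ∀ w : Plane, w = mfderiv (𝓡 2) 𝓘(ℝ, Plane) φ (φ.symm y) (T w) := by
      intro w
      have := mfderiv_extChartAt_comp_mfderivWithin_extChartAt_symm (I := 𝓡 2) (x := p) hyt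
      simp only [modelWithCornersSelf_coe, range_id, mfderivWithin_univ] at this
      exact (congrArg (fun S : Plane →L[ℝ] Plane ↦ S w) this).symm
    have hq : ∀ w : Plane, g.inner (φ.symm y) (T w) (T w) =
      w 0 ^ 2 * coeff g p y 0 0 + 2 * (w 0 * w 1) * coeff g p y 0 1
        + w 1 ^ 2 * coeff g p y 1 1 := fun w ↦ inner_mfderiv_eq_coeff g p y w _ rfl
    -- `hlow` and `hup` place the eigenvalues of the coefficient matrix between C₁⁻¹ and C₂, which
    -- controls the root of its determinant on both sides.
    have hlow : ∀ a b : ℝ, a ^ 2 + b ^ 2 ≤ C₁ * (a ^ 2 * coeff g p y 0 0 +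
        2 * (a * b) * coeff g p y 0 1 + b ^ 2 * coeff g p y 1 1) := by
      intro a b
      have := hy1 (T (!₂[a, b])) _ (hinv !₂[a, b])
      rw [hq, EuclideanSpace.norm_sq_eq] at this
      simpa using this
    have hup : ∀ a b : ℝ, a ^ 2 * coeff g p y 0 0 +
        2 * (a * b) * coeff g p y 0 1 + b ^ 2 * coeff g p y 1 1 ≤ C₂ * (a ^ 2 + b ^ 2) := by
      intro a b
      have := hy2 (!₂[a, b]) _ rfl
      rw [inner_mfderiv_eq_coeff g p y _ _ rfl, EuclideanSpace.norm_sq_eq] at this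
      simpa using this
    rw [Matrix.det_fin_two, coeff_symm g p y 1 0]
    set P := coeff g p y 0 0
    set Q := coeff g p y 0 1
    set S := coeff g p y 1 1
    have hP := hlow 1 0
    have hS := hlow 0 1
    have hP' := hup 1 0
    have hS' := hup 0 1
    norm_num at hP hS hP' hS'
    have hC : 0 < max C₁ C₂ := lt_max_of_lt_left hC₁
    constructor
    · refine (Real.sqrt_le_left hC.le).2 ?_
      have h1 : P * S ≤ C₂ * C₂ := by
        have : 0 < P := by
          by_contra hn
          nlinarith
        have : 0 < S := by
          by_contra hn
          nlinarith
        nlinarith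
      nlinarith [sq_nonneg Q, le_max_right C₁ C₂]
    · refine Real.le_sqrt_of_sq_le ?_
      -- With m = C₁⁻¹ the matrix minus m times the identity is positive semidefinite, so Q² ≤ (P -
      -- m)(S - m). Hence PS - Q² ≥ m(P + S) - m² ≥ m².
      have h3 : C₁⁻¹ ^ 2 ≤ P * S - Q * Q := by
        set m := C₁⁻¹ with hm
        have hm0 : 0 < m := inv_pos.2 hC₁
        have hlow' : ∀ a b : ℝ, 0 ≤ a ^ 2 * (P - m) + 2 * (a * b) * Q + b ^ 2 * (S - m) := by
          intro a b
          have := mul_le_mul_of_nonneg_left (hlow a b) hm0.le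
          rw [← mul_assoc, hm, inv_mul_cancel₀ hC₁.ne', one_mul, ← hm] at this
          linarith
        have hPm : 0 ≤ P - m := by simpa using hlow' 1 0
        have hSm : 0 ≤ S - m := by simpa using hlow' 0 1
        have hQ : Q ^ 2 ≤ (P - m) * (S - m) := by
          have := discrim_le_zero (a := P - m) (b := 2 * Q) (c := S - m) fun a ↦ by
            have := hlow' a 1
            linarith
          rw [discrim] at this
          linarith
        nlinarith
      refine le_trans (pow_le_pow_left₀ (inv_nonneg.2 hC.le) ?_ 2) h3
      exact inv_anti₀ hC₁ (le_max_left _ _)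

end

/-! ### Extension by zero from a chart -/

section

variable {M : Type*} [TopologicalSpace M] [ChartedSpace Plane M]

open scoped Classical in
/-- The function on the surface given by `f` in the chart around `p`, extended by zero. -/
noncomputable def chartExtend (p : M) (f : Plane → ℝ) (x : M) : ℝ :=
  if x ∈ (extChartAt (𝓡 2) p).source then f (extChartAt (𝓡 2) p x) else 0

theorem chartExtend_of_mem (p : M) (f : Plane → ℝ) {x : M}
    (hx : x ∈ (extChartAt (𝓡 2) p).source) :
    chartExtend p f x = f (extChartAt (𝓡 2) p x) := if_pos hx

theorem chartExtend_of_notMem (p : M) (f : Plane → ℝ) {x : M}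
    (hx : x ∉ (extChartAt (𝓡 2) p).source) : chartExtend p f x = 0 := if_neg hx

theorem chartExtend_eventuallyEq (p : M) (f : Plane → ℝ) {x : M}
    (hx : x ∈ (extChartAt (𝓡 2) p).source) :
    chartExtend p f =ᶠ[𝓝 x] f ∘ extChartAt (𝓡 2) p := by
  filter_upwards [(isOpen_extChartAt_source p).mem_nhds hx] with z hz
  exact chartExtend_of_mem p f hz

/-- The image of K in the surface is compact, hence closed by the Hausdorff property, so a point
outside the chart domain has a neighbourhood missing it. -/
theorem chartExtend_eventuallyEq_zero [T2Space M] (p : M) {f : Plane → ℝ} {K : Set Plane}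
    (hK : IsCompact K) (hKt : K ⊆ (extChartAt (𝓡 2) p).target) (hf : ∀ y ∉ K, f y = 0) {x : M}
    (hx : x ∉ (extChartAt (𝓡 2) p).source) : chartExtend p f =ᶠ[𝓝 x] fun _ ↦ 0 := by
  have hc : IsClosed ((extChartAt (𝓡 2) p).symm '' K) :=
    (hK.image_of_continuousOn ((continuousOn_extChartAt_symm p).mono hKt)).isClosed
  have hx' : x ∉ (extChartAt (𝓡 2) p).symm '' K := by
    rintro ⟨y, hy, rfl⟩
    exact hx ((extChartAt (𝓡 2) p).map_target (hKt hy))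
  filter_upwards [hc.isOpen_compl.mem_nhds hx'] with z hz
  by_cases hzs : z ∈ (extChartAt (𝓡 2) p).source
  · rw [chartExtend_of_mem p f hzs]
    refine hf _ fun hzK ↦ hz ⟨_, hzK, (extChartAt (𝓡 2) p).left_inv hzs⟩
  · exact chartExtend_of_notMem p f hzs

theorem extChartAt_target_inter_preimage_source (p : M) :
    (extChartAt (𝓡 2) p).target ∩ (extChartAt (𝓡 2) p).symm ⁻¹' (chartAt Plane p).source =
      (extChartAt (𝓡 2) p).target := by
  refine inter_eq_left.2 fun y hy ↦ ?_
  rw [mem_preimage, ← extChartAt_source (𝓡 2)]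
  exact (extChartAt (𝓡 2) p).map_target hy

variable [IsManifold (𝓡 2) ∞ M]

theorem contMDiff_chartExtend [T2Space M] (p : M) {f : Plane → ℝ} {K : Set Plane}
    (hK : IsCompact K) (hKt : K ⊆ (extChartAt (𝓡 2) p).target) (hf : ∀ y ∉ K, f y = 0)
    (hfs : ContDiff ℝ ∞ f) : ContMDiff (𝓡 2) 𝓘(ℝ, ℝ) ∞ (chartExtend p f) := by
  intro x
  by_cases hx : x ∈ (extChartAt (𝓡 2) p).source
  · refine ContMDiffAt.congr_of_eventuallyEq ?_ (chartExtend_eventuallyEq p f hx)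
    exact hfs.contMDiff.contMDiffAt.comp x
      (contMDiffAt_extChartAt' (by rwa [extChartAt_source] at hx))
  · exact contMDiffAt_const.congr_of_eventuallyEq (chartExtend_eventuallyEq_zero p hK hKt hf hx)

/-- The chain rule through the chart, followed by `sq_fderiv_le_energy`. -/
theorem sq_mfderiv_chartExtend_le (p : M) (f : Plane → ℝ) (hfs : ContDiff ℝ ∞ f)
    {x : M} (hx : x ∈ (extChartAt (𝓡 2) p).source) (v : TangentSpace (𝓡 2) x) (a : ℝ)
    (ha : a = mfderiv (𝓡 2) 𝓘(ℝ, ℝ) (chartExtend p f) x v) (w : Plane)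
    (hw : w = mfderiv (𝓡 2) 𝓘(ℝ, Plane) (extChartAt (𝓡 2) p) x v) :
    a ^ 2 ≤ energy f (extChartAt (𝓡 2) p x) * ‖w‖ ^ 2 := by
  have hd : MDifferentiableAt (𝓡 2) 𝓘(ℝ, Plane) (extChartAt (𝓡 2) p) x :=
    mdifferentiableAt_extChartAt (by rwa [extChartAt_source] at hx)
  have : a = fderiv ℝ f (extChartAt (𝓡 2) p x) w := by
    rw [ha, (chartExtend_eventuallyEq p f hx).mfderiv_eq, mfderiv_comp x (I' := 𝓘(ℝ, Plane))
      ((hfs.differentiable (by simp) _).mdifferentiableAt) hd, mfderiv_eq_fderiv, hw]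
    rfl
  rw [this]
  exact sq_fderiv_le_energy f _ w

end

/-! ### Area estimates and the construction of the metric -/

section

section

variable {M : Type*} [TopologicalSpace M] [ChartedSpace Plane M] [IsManifold (𝓡 2) ∞ M]
  [CompactSpace M]

theorem areaInChart_add_area_compl [Nonempty M] [MeasurableSpace M] [BorelSpace M] (g : Metric M)
    (p : M) : areaInChart g p (chartAt Plane p).source + area g (chartAt Plane p).sourceᶜ =
      totalArea g := by
  have hU : MeasurableSet (chartAt Plane p).source := (chartAt Plane p).open_source.measurableSet
  rw [← area_eq_areaInChart g p hU subset_rfl, totalArea, ← area_inter_add_diff g univ hU,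
    univ_inter, compl_eq_univ_sdiff]

/-- A small chart disc already has positive area, its density being bounded below. Positivity is
what permits rescaling to a prescribed area. -/
theorem totalArea_pos [Nonempty M] (g : Metric M) : 0 < totalArea g := by
  let _ : MeasurableSpace M := borel M
  have : BorelSpace M := ⟨rfl⟩
  obtain ⟨p⟩ := ‹Nonempty M›
  have : Nonempty M := ⟨p⟩
  obtain ⟨C, hC, R, hR, hsub, -, hdet⟩ := exists_chart_bounds g p
  rw [← areaInChart_add_area_compl g p]
  refine lt_of_lt_of_le ?_ le_self_add
  rw [areaInChart, extChartAt_target_inter_preimage_source]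
  refine lt_of_lt_of_le ?_ (lintegral_mono_set hsub)
  refine lt_of_lt_of_le ?_ (setLIntegral_mono' Metric.isClosed_closedBall.measurableSet
    fun y hy ↦ ENNReal.ofReal_le_ofReal (hdet y hy).2)
  rw [setLIntegral_const]
  exact ENNReal.mul_pos (ENNReal.ofReal_pos.2 (inv_pos.2 hC)).ne'
    (Metric.measure_closedBall_pos volume _ hR).ne'

/-- Off the chart domain the factor is 1 and nothing changes; inside, the added area is the integral
of h times the density of σ, which is at most C on K. -/
theorem totalArea_conformalChange_one_add_le [Nonempty M] (σ : Metric M) (p : M) {h : Plane → ℝ}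
    {K : Set Plane} {C : ℝ} (hC : 0 ≤ C) (hK : ∀ y ∉ K, h y = 0)
    (hdet : ∀ y ∈ K, √(coeff σ p y).det ≤ C) (h0 : ∀ y, 0 ≤ h y) (hc : Continuous h)
    (hi : Integrable h)
    (hf : ContMDiff (𝓡 2) 𝓘(ℝ, ℝ) ∞ fun x ↦ 1 + chartExtend p h x)
    (hpos : ∀ x, 0 < 1 + chartExtend p h x) :
    totalArea (conformalChange σ _ hf hpos) ≤ totalArea σ + ENNReal.ofReal (C * ∫ y, h y) := by
  let _ : MeasurableSpace M := borel M
  have : BorelSpace M := ⟨rfl⟩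
  have hU : MeasurableSet (chartAt Plane p).source := (chartAt Plane p).open_source.measurableSet
  have hcompl : area (conformalChange σ _ hf hpos) (chartAt Plane p).sourceᶜ =
      area σ (chartAt Plane p).sourceᶜ := by
    conv_rhs => rw [← conformalChange_one σ]
    refine area_conformalChange_congr _ _ _ _ _ _ _ hU.compl fun x hx ↦ ?_
    rw [chartExtend_of_notMem p h (by rwa [extChartAt_source]), add_zero]
  rw [← areaInChart_add_area_compl _ p, ← areaInChart_add_area_compl σ p, hcompl, add_right_comm]
  gcongr
  rw [areaInChart_conformalChange, areaInChart, extChartAt_target_inter_preimage_source,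
    ← integral_const_mul, ofReal_integral_eq_lintegral_ofReal (hi.const_mul C)
      (ae_of_all _ fun y ↦ mul_nonneg hC (h0 y))]
  refine le_trans ?_ (add_le_add_right (setLIntegral_le_lintegral (extChartAt (𝓡 2) p).target _) _)
  rw [← lintegral_add_right _ (by fun_prop)]
  refine setLIntegral_mono' (isOpen_extChartAt_target p).measurableSet fun y hy ↦ ?_
  rw [chartExtend_of_mem p h ((extChartAt (𝓡 2) p).map_target hy),
    (extChartAt (𝓡 2) p).right_inv hy, ENNReal.ofReal_add zero_le_one (h0 y), add_mul,
    ENNReal.ofReal_one, one_mul]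
  refine add_le_add_right ?_ _
  rw [← ENNReal.ofReal_mul (h0 y)]
  refine ENNReal.ofReal_le_ofReal ?_
  by_cases hy : y ∈ K
  · rw [mul_comm C]
    exact mul_le_mul_of_nonneg_left (hdet y hy) (h0 y)
  · simp [hK y hy]

end

/-- Every conformal class on a closed surface contains metrics of a given area and arbitrarily large
diameter. -/
theorem exists_isConformal_totalArea_eq_lt_diam {M : Type*} [TopologicalSpace M] [T2Space M]
    [CompactSpace M] [Nonempty M] [ChartedSpace Plane M] [IsManifold (𝓡 2) ∞ M] (σ : Metric M)
    (A : ℝ) (hA : totalArea σ = ENNReal.ofReal A) (D : ℝ) (hD : 0 < D) :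
    ∃ g : Metric M, IsConformal g σ ∧ totalArea g = ENNReal.ofReal A ∧
      ENNReal.ofReal D < diam g := by
  have hA0 : 0 < A := ENNReal.ofReal_pos.1 (hA ▸ totalArea_pos σ)
  obtain ⟨p⟩ := ‹Nonempty M›
  have : Nonempty M := ⟨p⟩
  obtain ⟨C, hC, R, hR, hsub, hw, hdet⟩ := exists_chart_bounds σ p
  set φ := extChartAt (𝓡 2) p with hφ
  set K := Metric.closedBall (φ p) R with hKdef
  have hK : IsCompact K := isCompact_closedBall _ _
  -- The added area will be at most C · C · (3D)² times the energy of G: one C comes from the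
  -- conformal factor, the other from the area density, and (3D)² from passing to H. The choice
  -- makes this at most 3A.
  obtain ⟨G, hG, hGp, hG0, hGE⟩ := exists_bump_integral_energy_le (φ p) hR
    (show 0 < 3 * A / (C * (C * (3 * D) ^ 2)) by positivity)
  let H : Plane → ℝ := fun y ↦ 3 * D * G y
  have hH : ContDiff ℝ ∞ H := contDiff_const.mul hG
  have hH0 : ∀ y ∉ Metric.ball (φ p) R, H y = 0 := fun y hy ↦ by simp [H, hG0 y hy]
  have hHK : ∀ y ∉ K, H y = 0 := fun y hy ↦ hH0 y fun h ↦ hy (Metric.ball_subset_closedBall h)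
  have hEK : ∀ y ∉ K, energy H y = 0 := fun y hy ↦ by
    refine energy_eq_zero_of_eventuallyEq_const (a := 0) ?_
    filter_upwards [Metric.isClosed_closedBall.isOpen_compl.mem_nhds hy] with z hz using hHK z hz
  let h : Plane → ℝ := fun y ↦ C * energy H y
  have hh : ContDiff ℝ ∞ h := contDiff_const.mul (contDiff_energy hH)
  have hhK : ∀ y ∉ K, h y = 0 := fun y hy ↦ by simp [h, hEK y hy]
  have hh0 : ∀ y, 0 ≤ h y := fun y ↦ mul_nonneg hC.le (energy_nonneg _ _)
  have hhi : Integrable h := (integrable_energy hH (.intro hK hHK)).const_mul C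
  have hint : C * ∫ y, h y ≤ 3 * A := by
    simp only [h, H, energy_const_mul, integral_const_mul]
    rw [le_div_iff₀ (by positivity)] at hGE
    linarith
  have hf : ContMDiff (𝓡 2) 𝓘(ℝ, ℝ) ∞ fun x ↦ 1 + chartExtend p h x :=
    contMDiff_const.add (contMDiff_chartExtend p hK hsub hhK hh)
  have hext0 : ∀ x, 0 ≤ chartExtend p h x := by
    intro x
    by_cases hx : x ∈ φ.source
    · rw [chartExtend_of_mem p h hx]
      exact hh0 _
    · rw [chartExtend_of_notMem p h hx]
  have hpos : ∀ x, 0 < 1 + chartExtend p h x := fun x ↦ by linarith [hext0 x]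
  set g₁ := conformalChange σ _ hf hpos with hg₁
  have harea : totalArea g₁ ≤ ENNReal.ofReal (4 * A) := by
    refine (totalArea_conformalChange_one_add_le σ p hC.le hhK (fun y hy ↦ (hdet y hy).1) hh0
      hh.continuous hhi hf hpos).trans ?_
    rw [hA, show 4 * A = A + 3 * A by ring, ENNReal.ofReal_add hA0.le (by positivity)]
    gcongr
  have htop : totalArea g₁ ≠ ⊤ := ne_top_of_le_ne_top ENNReal.ofReal_ne_top harea
  set a := (totalArea g₁).toReal with ha
  have ha0 : 0 < a := ENNReal.toReal_pos (totalArea_pos g₁).ne' htop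
  have ha4 : a ≤ 4 * A := ENNReal.toReal_le_of_le_ofReal (by positivity) harea
  -- The factor restoring area A; since a ≤ 4A, √s is at least 1/2.
  set s := A / a with hs
  have hs0 : 0 < s := by positivity
  have hs4 : 1 / 4 ≤ s := by
    rw [hs, le_div_iff₀ ha0]
    linarith
  have hsq : 1 / 2 ≤ √s := Real.le_sqrt_of_sq_le (by norm_num; linarith)
  have hf' : ContMDiff (𝓡 2) 𝓘(ℝ, ℝ) ∞ fun x ↦ s * (1 + chartExtend p h x) :=
    contMDiff_const.mul hf
  refine ⟨conformalChange σ _ hf' fun x ↦ mul_pos hs0 (hpos x), isConformal_conformalChange _ _ _ _,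
    ?_, ?_⟩
  · rw [totalArea_conformalChange_const_mul σ _ s hs0 hf hpos, ← hg₁, ← ENNReal.ofReal_toReal htop,
      ← ha, ← ENNReal.ofReal_mul hs0.le, hs, div_mul_cancel₀ _ ha0.ne']
  -- Multiplying the metric by s multiplies lengths by √s, so √s · H is the function that stays
  -- 1-Lipschitz.
  let F : Plane → ℝ := fun y ↦ √s * H y
  have hF : ContDiff ℝ ∞ F := contDiff_const.mul hH
  have hFK : ∀ y ∉ K, F y = 0 := fun y hy ↦ by simp [F, hHK y hy]
  have hFE : ∀ y, energy F y = s * energy H y := fun y ↦ by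
    simp only [F, energy_const_mul, Real.sq_sqrt hs0.le]
  -- A point on the boundary circle of the disc, where H already vanishes.
  set q := φ.symm (φ p + R • stdVec 0) with hq
  have hnorm : ‖stdVec 0‖ = 1 := by simp [stdVec]
  have hqK : φ p + R • stdVec 0 ∈ K := by
    simp [K, dist_eq_norm, norm_smul, hnorm, abs_of_pos hR]
  have hFq : chartExtend p F q = 0 := by
    rw [chartExtend_of_mem p F (φ.map_target (hsub hqK)), ← hφ, φ.right_inv (hsub hqK)]
    simp only [F]
    rw [hH0, mul_zero]
    simp [dist_eq_norm, norm_smul, hnorm, abs_of_pos hR]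
  have hFp : chartExtend p F p = √s * (3 * D) := by
    rw [chartExtend_of_mem p F (mem_extChartAt_source p), ← hφ]
    simp only [F, H, hGp, mul_one]
  have hdist := ofReal_sub_le_gdist (conformalChange σ _ hf' fun x ↦ mul_pos hs0 (hpos x))
    ((contMDiff_chartExtend p hK hsub hFK hF).of_le (n := ∞) (m := 1) (by simp)) (fun x v b hb ↦ by
      rw [conformalChange_inner]
      have hv : 0 ≤ σ.inner x v v := by
        by_cases hv : v = 0
        · simp [hv]
        · exact (σ.pos x v hv).le
      by_cases hx : x ∈ φ.source
      · have h1 := sq_mfderiv_chartExtend_le p F hF hx v b hb _ rfl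
        refine h1.trans ?_
        rw [chartExtend_of_mem p h hx, hFE, ← hφ]
        by_cases hxK : φ x ∈ K
        · have h2 := hw x hx hxK v _ rfl
          have h3 := mul_le_mul_of_nonneg_left h2
            (mul_nonneg hs0.le (energy_nonneg H (φ x)))
          refine h3.trans ?_
          simp only [h]
          -- The two sides differ exactly by s · σ(v, v), the contribution of the 1 in 1 + h.
          nlinarith [mul_nonneg hs0.le hv]
        · simp only [h, hEK _ hxK, mul_zero, zero_mul, add_zero, mul_one]
          exact mul_nonneg hs0.le hv
      · have hb0 : b = 0 := by
          rw [hb, (chartExtend_eventuallyEq_zero p hK hsub hFK hx).mfderiv_eq, mfderiv_const]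
          rfl
        rw [hb0, zero_pow two_ne_zero]
        exact mul_nonneg (mul_pos hs0 (hpos x)).le hv) q p
  rw [hFq, hFp, sub_zero] at hdist
  refine lt_of_lt_of_le ?_ (hdist.trans ((le_iSup (fun y ↦ gdist _ q y) p).trans
    (le_iSup (fun x ↦ ⨆ y, gdist _ x y) q)))
  -- √s · 3D ≥ 3D/2 > D; the constant 3 makes the inequality strict.
  exact (ENNReal.ofReal_lt_ofReal_iff (by positivity)).2 (by nlinarith)

end

end Surface


theorem lemma4p3 {M : Type*} [TopologicalSpace M] [T2Space M] [CompactSpace M] [ConnectedSpace M]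
    [ChartedSpace Surface.Plane M] [IsManifold (𝓡 2) ∞ M]
    (σ : Surface.Metric M) (hσ : Surface.IsHyperbolic σ)
    (A : ℝ) (hA : Surface.totalArea σ = ENNReal.ofReal A) (D : ℝ) (hD : 0 < D) :
    ∃ g : Surface.Metric M, Surface.IsConformal g σ ∧
      Surface.totalArea g = ENNReal.ofReal A ∧ ENNReal.ofReal D < Surface.diam g :=
  Surface.exists_isConformal_totalArea_eq_lt_diam σ A hA D hD
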